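/- Let $(\lambda_n)_{n\ge 1}$ be a sequence of nonzero complex numbers for which there are $\alpha_0,\beta_0\in(0,1)$ with $\operatorname{Re}\lambda_n\ge\beta_0|\lambda_n|$ for all $n$ and $\sum_{n\ge1}|\lambda_n|^{-\alpha_0}<\infty$. Suppose that $$f(z)=\prod_{n=1}^{\infty}\Bigl(1+\frac{z}{\lambda_n}\Bigr)=\sum_{n=0}^{\infty}a_nz^n\quad(z\in\mathbb C),\qquad a_0=1,\quad a_n>0\ \text{ for all } n\in\mathbb N .$$ Then there is a unique sequence $(m_k)_{k\ge0}$ of complex numbers such that $$\frac{f'(0)}{z}-\frac{f'(z)}{z f(z)}=\sum_{k=0}^{\infty}m_k(-z)^k$$ for all sufficiently small $z\ne0$. The numbers $m_k$ are real, and the expansion holds for all $0<|z|<\min_n|\lambda_n|$ (in particular for $0<|z|<1$ if $|\lambda_n|\ge1$ for all $n$). Moreover: (i) The functions $\frac{f'(0)}{z}-\frac{f'(z)}{zf(z)}$ (continued to $z=0$ by its limit) and $\frac{f'(z)}{f(z)}$ are analytic at $0$, and for every $k\ge0$ $$m_k=\frac{(-1)^k}{k!}\,\frac{d^k}{dz^k}\Bigl(\frac{f'(0)}{z}-\frac{f'(z)}{zf(z)}\Bigr)\Big|_{z=0}=\frac{(-1)^{k+1}}{(k+1)!}\Bigl(\frac{f'}{f}\Bigr)^{(k+1)}(0)=\sum_{n=1}^{\infty}\frac1{\lambda_n^{k+2}}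 .$$ (ii) With $\Delta m_n=m_{n+1}-m_n$, for all $n,k\ge0$ $$(-1)^k\Delta^km_n=\sum_{j=1}^{\infty}\frac1{\lambda_j^{n+2}}\Bigl(1-\frac1{\lambda_j}\Bigr)^k .$$ If $\inf_n\operatorname{Re}\lambda_n>1$, then all $\lambda_n$ are positive real numbers if and only if $(-1)^k\Delta^km_n\ge0$ for all $n,k\ge0$. (iii) For every $\ell\ge0$, $(-1)^\ell m_\ell=\det\bigl(M^{(\ell)}\bigr)$, where $M^{(\ell)}=(M_{ij})_{0\le i,j\le\ell}$ has the entries $M_{ij}=a_{i-j}$ for $j\le i$, $j<\ell$ (so $M_{ii}=1$ for $i<\ell$), $M_{ij}=0$ for $i<j<\ell$, and last column $M_{i\ell}=a_1a_{i+1}-(i+2)a_{i+2}$. (iv) For every $\ell\ge0$, $$(-1)^\ell m_\ell=a_1a_{\ell+1}-(\ell+2)a_{\ell+2}-\sum_{k=1}^{\ell}(-1)^{\ell-k}m_{\ell-k}\,a_k .$$ -/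

import Mathlib

open Filter Topology

/-- The infinite product `f(z) = ∏ₙ (1 + z / Λₙ)`. -/
noncomputable def canonicalProd (Λ : ℕ → ℂ) (z : ℂ) : ℂ :=
  ∏' n, (1 + z / Λ n)

/-- `f'(0)/z - f'(z)/(z f(z))` for `f` the product attached to `Λ` (meaningful for `z ≠ 0` with
`f(z) ≠ 0`). -/
noncomputable def momentGen (Λ : ℕ → ℂ) (z : ℂ) : ℂ :=
  deriv (canonicalProd Λ) 0 / z
    - deriv (canonicalProd Λ) z / (z * canonicalProd Λ z)

/-- `f'(0)/z - f'(z)/(z f(z))` with the singularity at the origin removed: the value at `0` is the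
limit as `z → 0`, `z ≠ 0`. -/
noncomputable def momentGenExt (Λ : ℕ → ℂ) : ℂ → ℂ :=
  Function.update (momentGen Λ) 0 (limUnder (𝓝[≠] 0) (momentGen Λ))

/-- `m` is the coefficient sequence of the expansion
`f'(0)/z - f'(z)/(z f(z)) = ∑ₖ mₖ (-z)ᵏ` around the origin. -/
def IsMomentSeq (Λ : ℕ → ℂ) (m : ℕ → ℂ) : Prop :=
  ∃ r : ℝ, 0 < r ∧ ∀ z : ℂ, z ≠ 0 → ‖z‖ < r →
    HasSum (fun k : ℕ => m k * (-z) ^ k) (momentGen Λ z)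

/-- The `(ℓ+1) × (ℓ+1)` matrix whose columns `j < ℓ` are those of the lower triangular Toeplitz
matrix `(a_{i-j})` and whose last column is `(a₁ a_{i+1} - (i+2) a_{i+2})ᵢ`, `0 ≤ i ≤ ℓ`. -/
def momentMatrix (a : ℕ → ℝ) (l : ℕ) : Matrix (Fin (l + 1)) (Fin (l + 1)) ℝ :=
  Matrix.of fun i j =>
    if (j : ℕ) = l then a 1 * a ((i : ℕ) + 1) - ((i : ℕ) + 2 : ℝ) * a ((i : ℕ) + 2)
    else if (j : ℕ) ≤ (i : ℕ) then a ((i : ℕ) - (j : ℕ))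
    else 0

/-! Logarithmic differentiation gives `f'/f = ∑ 1/(λₙ + z)`, so the generating function is `∑
1/(λₙ(λₙ + z))`; expanding geometrically and interchanging sums gives `m_k = ∑ λₙ^{-(k+2)}`
(`hasSum_inversePowerSum_mul_pow`). Multiplying by `f` and comparing coefficients yields a
unitriangular system for `(-1)^k m_k` (`sum_coeff_mul_inversePowerSum`): hence reality, the
recursion and, by Cramer, the determinant.

For positive `λₙ ≥ 1` the signs of the differences are visible termwise. Conversely, if `m` is
completely monotone, Hausdorff's theorem supplies a functional `g` on `C([0,1])` with `g(x^k) =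
m_k`. Then `G(z) = g((1 + zx)⁻¹)` continues the generating function to `ℂ \ (-∞, -1]`, and `f' = f ·
(f'(0) - zG)` persists there. At a zero of `f` in that domain `f'` would vanish to at least the
order of `f`, which is impossible; so every `-λⱼ` is a negative real
(`roots_pos_of_completelyMonotone`). -/

/-! ### Summability of `1/λₙ` and uniqueness of power series coefficients. -/

theorem summable_inv_norm_of_rpow {Λ : ℕ → ℂ} {α : ℝ} (hα : 0 < α) (hα1 : α ≤ 1)
    (hΛ : ∀ n, Λ n ≠ 0) (hs : Summable fun n => 1 / ‖Λ n‖ ^ α) :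
    Summable fun n => ‖(Λ n)⁻¹‖ := by
  refine hs.of_norm_bounded_eventually_nat ?_
  filter_upwards [hs.tendsto_atTop_zero.eventually_le_const one_pos] with n hn
  have hp : 0 < ‖Λ n‖ := norm_pos_iff.2 (hΛ n)
  have hq : 0 < ‖Λ n‖ ^ α := Real.rpow_pos_of_pos hp _
  have h1 : 1 ≤ ‖Λ n‖ ^ α := by
    rw [div_le_one hq] at hn; exact hn
  have h2 : 1 ≤ ‖Λ n‖ := by
    by_contra! h
    exact absurd (Real.rpow_lt_one hp.le h hα) (not_lt.2 h1)
  rw [norm_norm, norm_inv, ← one_div]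
  refine one_div_le_one_div_of_le hq ?_
  simpa using Real.rpow_le_rpow_of_exponent_le h2 hα1

theorem hasFPowerSeriesAt_ofScalars_of_eventually_hasSum {c : ℕ → ℂ} {φ : ℂ → ℂ}
    (h : ∀ᶠ z in 𝓝 (0 : ℂ), HasSum (fun k => c k * z ^ k) (φ z)) :
    HasFPowerSeriesAt φ (FormalMultilinearSeries.ofScalars ℂ c) 0 := by
  rw [hasFPowerSeriesAt_iff]
  filter_upwards [h] with z hz
  simpa [FormalMultilinearSeries.coeff_ofScalars, mul_comm] using hz

theorem coeff_eq_iteratedDeriv_div_factorial {c : ℕ → ℂ} {φ : ℂ → ℂ}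
    (h : ∀ᶠ z in 𝓝 (0 : ℂ), HasSum (fun k => c k * z ^ k) (φ z)) (k : ℕ) :
    c k = iteratedDeriv k φ 0 / (k.factorial : ℂ) := by
  have h1 := hasFPowerSeriesAt_ofScalars_of_eventually_hasSum h
  have h2 := h1.analyticAt.hasFPowerSeriesAt
  have h3 := congrArg (fun p => FormalMultilinearSeries.coeff p k)
    (h1.eq_formalMultilinearSeries h2)
  simpa [FormalMultilinearSeries.coeff_ofScalars] using h3

theorem AnalyticAt.eventually_hasSum_iteratedDeriv {φ : ℂ → ℂ} (h : AnalyticAt ℂ φ 0) :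
    ∀ᶠ z in 𝓝 (0 : ℂ),
      HasSum (fun k => iteratedDeriv k φ 0 / (k.factorial : ℂ) * z ^ k) (φ z) := by
  have h2 := hasFPowerSeriesAt_iff.1 h.hasFPowerSeriesAt
  filter_upwards [h2] with z hz
  simpa [FormalMultilinearSeries.coeff_ofScalars, mul_comm] using hz

/-- Replacing `φ` by the sum of the series discards a possibly wrong value of `φ` at `0`. -/
theorem eventually_nhds_zero_hasSum_tsum {c : ℕ → ℂ} {φ : ℂ → ℂ}
    (h : ∀ᶠ z in 𝓝[≠] (0 : ℂ), HasSum (fun k => c k * z ^ k) (φ z)) :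
    ∀ᶠ z in 𝓝 (0 : ℂ), HasSum (fun k => c k * z ^ k) (∑' k, c k * z ^ k) := by
  rw [eventually_nhdsWithin_iff] at h
  filter_upwards [h] with z hz
  by_cases h0 : z = 0
  · subst h0
    exact (hasSum_single 0 fun k hk => by simp [hk]).summable.hasSum
  · exact (hz h0).summable.hasSum

theorem coeff_unique_of_eventually_hasSum {c d : ℕ → ℂ} {φ : ℂ → ℂ}
    (hc : ∀ᶠ z in 𝓝[≠] (0 : ℂ), HasSum (fun k => c k * z ^ k) (φ z))
    (hd : ∀ᶠ z in 𝓝[≠] (0 : ℂ), HasSum (fun k => d k * z ^ k) (φ z)) : c = d := by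
  have h1 := eventually_nhds_zero_hasSum_tsum hc
  have h2 := eventually_nhds_zero_hasSum_tsum hd
  have e : ∀ᶠ z in 𝓝[≠] (0 : ℂ), (∑' k, c k * z ^ k) = ∑' k, d k * z ^ k := by
    filter_upwards [hc, hd] with z a b
    rw [a.tsum_eq, b.tsum_eq]
  have e' := ((hasFPowerSeriesAt_ofScalars_of_eventually_hasSum h1).analyticAt.frequently_eq_iff_eventually_eq
    (hasFPowerSeriesAt_ofScalars_of_eventually_hasSum h2).analyticAt).1 e.frequently
  funext k
  rw [coeff_eq_iteratedDeriv_div_factorial h1 k, coeff_eq_iteratedDeriv_div_factorial h2 k,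
    Filter.EventuallyEq.iteratedDeriv_eq k e']

/-! ### The canonical product and its logarithmic derivative. -/

section Product

variable {Λ : ℕ → ℂ}

theorem hasProdLocallyUniformlyOn_canonicalProd (hs : Summable fun n => ‖(Λ n)⁻¹‖) :
    HasProdLocallyUniformlyOn (fun n z => 1 + z / Λ n) (canonicalProd Λ) Set.univ := by
  refine hasProdLocallyUniformlyOn_of_forall_compact isOpen_univ fun K _ hK => ?_
  obtain ⟨R, hR⟩ := hK.isBounded.exists_norm_le
  refine Summable.hasProdUniformlyOn_one_add hK (hs.mul_left R) (.of_forall fun n z hz => ?_)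
    fun n => by fun_prop
  rw [div_eq_mul_inv, norm_mul]
  exact mul_le_mul_of_nonneg_right (hR z hz) (norm_nonneg _)

theorem differentiable_canonicalProd (hs : Summable fun n => ‖(Λ n)⁻¹‖) :
    Differentiable ℂ (canonicalProd Λ) := by
  rw [← differentiableOn_univ]
  refine (hasProdLocallyUniformlyOn_canonicalProd hs).differentiableOn (.of_forall fun s => ?_)
    isOpen_univ
  fun_prop

theorem canonicalProd_zero : canonicalProd Λ 0 = 1 := by simp [canonicalProd]

theorem canonicalProd_neg_root (hΛ : ∀ n, Λ n ≠ 0) (n : ℕ) : canonicalProd Λ (-Λ n) = 0 :=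
  tprod_of_exists_eq_zero ⟨n, by rw [neg_div, div_self (hΛ n)]; ring⟩

theorem one_add_div_ne_zero_of_ne {z w : ℂ} (hw : w ≠ 0) (h : z ≠ -w) : 1 + z / w ≠ 0 := by
  intro e
  apply h
  field_simp at e
  linear_combination e

theorem canonicalProd_ne_zero (hs : Summable fun n => ‖(Λ n)⁻¹‖) (hΛ : ∀ n, Λ n ≠ 0) {z : ℂ}
    (hz : ∀ n, z ≠ -Λ n) : canonicalProd Λ z ≠ 0 := by
  refine tprod_one_add_ne_zero_of_summable
    (fun n => one_add_div_ne_zero_of_ne (hΛ n) (hz n)) ?_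
  simpa [div_eq_mul_inv] using hs.mul_left ‖z‖

theorem hasSum_logDeriv_canonicalProd (hs : Summable fun n => ‖(Λ n)⁻¹‖) (hΛ : ∀ n, Λ n ≠ 0)
    {z : ℂ} (hz : ∀ n, z ≠ -Λ n) (hsz : Summable fun n => 1 / (Λ n + z)) :
    HasSum (fun n => 1 / (Λ n + z)) (deriv (canonicalProd Λ) z / canonicalProd Λ z) := by
  have hld : ∀ n, logDeriv (fun w => 1 + w / Λ n) z = 1 / (Λ n + z) := by
    intro n
    have h1 : Λ n + z ≠ 0 := fun h => hz n (by linear_combination h)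
    have h2 := hΛ n
    have h3 : deriv (fun w => 1 + w / Λ n) z = 1 / Λ n := by simp
    rw [logDeriv_apply, h3]
    field_simp
  have h := logDeriv_tprod_eq_tsum isOpen_univ (Set.mem_univ z)
    (fun n => one_add_div_ne_zero_of_ne (hΛ n) (hz n)) (fun n => by fun_prop)
    (by simpa only [hld] using hsz)
    (hasProdLocallyUniformlyOn_canonicalProd hs).multipliableLocallyUniformlyOn
    (canonicalProd_ne_zero hs hΛ hz)
  simp only [hld] at h
  have h' : deriv (canonicalProd Λ) z / canonicalProd Λ z = ∑' n, 1 / (Λ n + z) := by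
    rw [← h, logDeriv_apply]; rfl
  rw [h']
  exact hsz.hasSum

/-- The power sum `∑ₙ Λₙ^{-(k+2)}`. -/
noncomputable def inversePowerSum (Λ : ℕ → ℂ) (k : ℕ) : ℂ := ∑' n, (Λ n)⁻¹ ^ (k + 2)

theorem hasSum_inversePowerSum (hs : Summable fun n => ‖(Λ n)⁻¹‖) (k : ℕ) :
    HasSum (fun n => (Λ n)⁻¹ ^ (k + 2)) (inversePowerSum Λ k) := by
  refine Summable.hasSum (hs.of_norm_bounded_eventually_nat ?_)
  filter_upwards [hs.tendsto_atTop_zero.eventually_le_const one_pos] with n hn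
  rw [norm_pow]
  exact pow_le_of_le_one (norm_nonneg _) hn (by omega)

theorem exists_pos_forall_le_norm (hs : Summable fun n => ‖(Λ n)⁻¹‖) (hΛ : ∀ n, Λ n ≠ 0) :
    ∃ r : ℝ, 0 < r ∧ ∀ n, r ≤ ‖Λ n‖ := by
  have h0 : 0 ≤ ∑' n, ‖(Λ n)⁻¹‖ := tsum_nonneg fun _ => norm_nonneg _
  refine ⟨(1 + ∑' n, ‖(Λ n)⁻¹‖)⁻¹, by positivity, fun n => ?_⟩
  have h1 : ‖(Λ n)⁻¹‖ ≤ ∑' n, ‖(Λ n)⁻¹‖ := hs.le_tsum n fun _ _ => norm_nonneg _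
  rw [norm_inv] at h1
  exact inv_le_of_inv_le₀ (norm_pos_iff.2 (hΛ n)) (by linarith)

/-- `S` is the sum of one absolutely convergent double series: summing over `k` first gives the
fractions, over `n` first the power sums. -/
theorem hasSum_inversePowerSum_mul_pow (hs : Summable fun n => ‖(Λ n)⁻¹‖) (hΛ : ∀ n, Λ n ≠ 0)
    {z : ℂ} (hz : ∀ n, ‖z‖ < ‖Λ n‖) :
    ∃ S, HasSum (fun n => 1 / (Λ n * (Λ n + z))) S ∧
      HasSum (fun k => inversePowerSum Λ k * (-z) ^ k) S := by
  have hlt : ∀ n, ‖(Λ n)⁻¹ * -z‖ < 1 := by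
    intro n
    rw [norm_mul, norm_neg, norm_inv, inv_mul_lt_iff₀ (norm_pos_iff.2 (hΛ n)), mul_one]
    exact hz n
  have hsq : Summable fun n => ‖(Λ n)⁻¹‖ ^ 2 := by
    simpa [norm_pow, inv_pow] using (hasSum_inversePowerSum hs 0).summable.norm
  have hS : Summable fun p : ℕ × ℕ => (Λ p.1)⁻¹ ^ 2 * ((Λ p.1)⁻¹ * -z) ^ p.2 := by
    apply Summable.of_norm
    rw [summable_prod_of_nonneg fun _ => norm_nonneg _]
    simp only [norm_mul _ (_ ^ _), norm_pow]
    refine ⟨fun n => ((summable_geometric_of_lt_one (norm_nonneg _) (hlt n)).mul_left _), ?_⟩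
    simp_rw [tsum_mul_left, tsum_geometric_of_lt_one (norm_nonneg _) (hlt _)]
    -- For large `n` the ratio is at most `1/2`, so the geometric sum is at most `2`.
    refine (hsq.mul_right 2).of_norm_bounded_eventually_nat ?_
    have ht : Tendsto (fun n => ‖(Λ n)⁻¹ * -z‖) atTop (𝓝 0) := by
      simpa [norm_mul] using hs.tendsto_atTop_zero.mul_const ‖z‖
    filter_upwards [ht.eventually_le_const (show (0 : ℝ) < 1 / 2 by norm_num)] with n hn
    rw [norm_mul, Real.norm_of_nonneg (by positivity),
      Real.norm_of_nonneg (inv_nonneg.2 (by linarith))]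
    refine mul_le_mul_of_nonneg_left ?_ (by positivity)
    rw [inv_le_comm₀ (by linarith) (by norm_num)]
    linarith
  refine ⟨∑' p : ℕ × ℕ, (Λ p.1)⁻¹ ^ 2 * ((Λ p.1)⁻¹ * -z) ^ p.2, ?_, ?_⟩
  · refine hS.hasSum.prod_fiberwise fun n => ?_
    have := (hasSum_geometric_of_norm_lt_one (hlt n)).mul_left ((Λ n)⁻¹ ^ 2)
    convert! this using 1
    have h1 : Λ n + z ≠ 0 := by
      intro h
      have : z = -Λ n := by linear_combination h
      simpa [this] using hz n
    have h2 := hΛ n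
    have h3 : 1 - (Λ n)⁻¹ * -z = (Λ n + z) / Λ n := by field_simp; ring
    rw [h3]
    field_simp
  · have h' := (Equiv.prodComm ℕ ℕ).hasSum_iff.2 hS.hasSum
    refine HasSum.prod_fiberwise h' fun k => ?_
    convert! (hasSum_inversePowerSum hs k).mul_right ((-z) ^ k) using 1
    funext n
    simp only [Function.comp, Equiv.prodComm_apply, Prod.swap]
    ring

theorem summable_one_div_add (hs : Summable fun n => ‖(Λ n)⁻¹‖) (hΛ : ∀ n, Λ n ≠ 0)
    {z S : ℂ} (hz : ∀ n, z ≠ -Λ n) (hS : HasSum (fun n => 1 / (Λ n * (Λ n + z))) S) :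
    HasSum (fun n => 1 / (Λ n + z)) (∑' n, (Λ n)⁻¹ - z * S) := by
  convert! hs.of_norm.hasSum.sub (hS.mul_left z) using 1
  funext n
  have h1 : Λ n + z ≠ 0 := fun h => hz n (by linear_combination h)
  have h2 := hΛ n
  field_simp
  ring

theorem deriv_canonicalProd_zero (hs : Summable fun n => ‖(Λ n)⁻¹‖) (hΛ : ∀ n, Λ n ≠ 0) :
    deriv (canonicalProd Λ) 0 = ∑' n, (Λ n)⁻¹ := by
  have hz : ∀ n, (0 : ℂ) ≠ -Λ n := fun n h => hΛ n (by simpa using h.symm)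
  have h := (hasSum_logDeriv_canonicalProd hs hΛ hz
    (by simpa using hs.of_norm)).tsum_eq
  simpa [canonicalProd_zero] using h.symm

theorem deriv_div_canonicalProd_eq (hs : Summable fun n => ‖(Λ n)⁻¹‖) (hΛ : ∀ n, Λ n ≠ 0)
    {z S : ℂ} (hz : ∀ n, ‖z‖ < ‖Λ n‖)
    (hS : HasSum (fun k => inversePowerSum Λ k * (-z) ^ k) S) :
    deriv (canonicalProd Λ) z / canonicalProd Λ z = deriv (canonicalProd Λ) 0 - z * S := by
  obtain ⟨T, hT, hT'⟩ := hasSum_inversePowerSum_mul_pow hs hΛ hz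
  obtain rfl := hT'.unique hS
  have hz' : ∀ n, z ≠ -Λ n := fun n h => by simpa [h] using hz n
  have h := summable_one_div_add hs hΛ hz' hT
  rw [(hasSum_logDeriv_canonicalProd hs hΛ hz' h.summable).unique h,
    deriv_canonicalProd_zero hs hΛ]

theorem hasSum_momentGen (hs : Summable fun n => ‖(Λ n)⁻¹‖) (hΛ : ∀ n, Λ n ≠ 0)
    {z : ℂ} (h0 : z ≠ 0) (hz : ∀ n, ‖z‖ < ‖Λ n‖) :
    HasSum (fun k => inversePowerSum Λ k * (-z) ^ k) (momentGen Λ z) := by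
  obtain ⟨S, -, hS⟩ := hasSum_inversePowerSum_mul_pow hs hΛ hz
  have h := deriv_div_canonicalProd_eq hs hΛ hz hS
  have : momentGen Λ z = S := by
    rw [momentGen, mul_comm z, ← div_div, h]
    field_simp
    ring
  rwa [this]

end Product

/-! ### The Hausdorff moment problem and the Stieltjes transform. -/

section Hausdorff

open Polynomial

/-- The Bernstein weight `C(N, k) (-1)^{N-k} Δ^{N-k} m_k` of a sequence `m`. -/
noncomputable def bernsteinWeight (m : ℕ → ℝ) (N k : ℕ) : ℝ :=
  N.choose k * ((-1) ^ (N - k) * (fwdDiff 1)^[N - k] m k)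

/-- Under the linear functional `X^k ↦ m_k`, multiplication by `1 - X` becomes `-Δ`. -/
theorem constr_X_pow_mul_one_sub_X_pow (m : ℕ → ℝ) (k j : ℕ) :
    (basisMonomials ℝ).constr ℝ m (X ^ k * (1 - X) ^ j) = (-1) ^ j * (fwdDiff 1)^[j] m k := by
  induction j generalizing k with
  | zero =>
    have : (X ^ k : ℝ[X]) = basisMonomials ℝ k := by simp [X_pow_eq_monomial]
    rw [pow_zero, mul_one, this, Module.Basis.constr_basis]
    simp
  | succ j ih =>
    have : (X ^ k * (1 - X) ^ (j + 1) : ℝ[X]) =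
        X ^ k * (1 - X) ^ j - X ^ (k + 1) * (1 - X) ^ j := by ring
    rw [this, map_sub, ih, ih, Function.iterate_succ_apply']
    simp only [fwdDiff]
    ring

/-- Factorial moments of the binomial distribution: terms with `k < d` vanish, and the rest reduce
to `(X + (1 - X))^n = 1`. -/
theorem sum_descFactorial_mul_choose_mul_X_pow (d n : ℕ) :
    ∑ k ∈ Finset.range (d + n + 1),
      (((k.descFactorial d * (d + n).choose k : ℕ) : ℝ) • (X ^ k * (1 - X) ^ (d + n - k)) : ℝ[X]) =
      (((d + n).descFactorial d : ℕ) : ℝ) • X ^ d := by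
  rw [add_assoc, Finset.sum_range_add, Finset.sum_eq_zero, zero_add]
  · have h : ∀ i ∈ Finset.range (n + 1),
        ((((d + i).descFactorial d * (d + n).choose (d + i) : ℕ) : ℝ) •
          (X ^ (d + i) * (1 - X) ^ (d + n - (d + i))) : ℝ[X]) =
        ((((d + n).descFactorial d : ℕ) : ℝ) • X ^ d) * (X ^ i * (1 - X) ^ (n - i) * (n.choose i : ℝ[X])) := by
      intro i _
      have hc : (d + i).descFactorial d * (d + n).choose (d + i) =
          (d + n).descFactorial d * n.choose i := by
        have := Nat.choose_mul (n := d + n) (k := d + i) (s := d) (by omega)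
        simp only [Nat.add_sub_cancel_left] at this
        rw [Nat.descFactorial_eq_factorial_mul_choose, Nat.descFactorial_eq_factorial_mul_choose,
          mul_assoc, mul_assoc, ← this]
        ring
      rw [hc, Nat.add_sub_add_left]
      simp only [smul_eq_C_mul, Nat.cast_mul, map_mul, map_natCast]
      ring
    rw [Finset.sum_congr rfl h, ← Finset.mul_sum, ← add_pow]
    simp
  · intro k hk
    rw [Nat.descFactorial_of_lt (Finset.mem_range.1 hk)]
    simp

theorem sum_descFactorial_mul_bernsteinWeight (m : ℕ → ℝ) {d N : ℕ} (h : d ≤ N) :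
    ∑ k ∈ Finset.range (N + 1), (k.descFactorial d : ℝ) / N.descFactorial d *
      bernsteinWeight m N k = m d := by
  obtain ⟨n, rfl⟩ := Nat.exists_eq_add_of_le h
  have e := congrArg ((basisMonomials ℝ).constr ℝ m) (sum_descFactorial_mul_choose_mul_X_pow d n)
  have hd := constr_X_pow_mul_one_sub_X_pow m d 0
  simp only [map_sum, map_smul, constr_X_pow_mul_one_sub_X_pow] at e
  simp only [pow_zero, mul_one, Function.iterate_zero, id, one_mul] at hd
  rw [hd] at e
  have hp : ((d + n).descFactorial d : ℝ) ≠ 0 := by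
    simp [Nat.descFactorial_eq_zero_iff_lt]
  rw [← mul_right_inj' hp, ← smul_eq_mul (a := ((d + n).descFactorial d : ℝ)) (b := m d), ← e,
    Finset.mul_sum]
  refine Finset.sum_congr rfl fun k _ => ?_
  simp only [bernsteinWeight, smul_eq_mul, Nat.cast_mul]
  field_simp

/-- The quotient of falling factorials is a product of factors `(k - i)/(N - i)`, each within `i/(N
- i)` of `k/N`. Only the decay as `N → ∞` matters. -/
theorem abs_div_pow_sub_descFactorial_div_le (d N k : ℕ) (hN : d < N) (hk : k ≤ N) :
    |((k : ℝ) / N) ^ d - (k.descFactorial d : ℝ) / N.descFactorial d| ≤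
      d * ((d : ℝ) / (N - d)) := by
  induction d with
  | zero => simp
  | succ d ih =>
    have ih := ih (by omega)
    have hN' : ((d + 1 : ℕ) : ℝ) < N := by exact_mod_cast hN
    push_cast at hN' ⊢
    have hN0 : (0 : ℝ) < N := by exact_mod_cast Nat.zero_lt_of_lt hN
    have hNd : (0 : ℝ) < N - d := by linarith
    have hNd' : (0 : ℝ) < N - (d + 1) := by linarith
    have hkN : (k : ℝ) ≤ N := by exact_mod_cast hk
    have hp : (0 : ℝ) ≤ (k : ℝ) / N := by positivity
    have hp1 : (k : ℝ) / N ≤ 1 := div_le_one_of_le₀ hkN hN0.le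
    have hq : (0 : ℝ) ≤ (k.descFactorial d : ℝ) / N.descFactorial d := by positivity
    have hq1 : (k.descFactorial d : ℝ) / N.descFactorial d ≤ 1 :=
      div_le_one_of_le₀ (by exact_mod_cast Nat.descFactorial_le d hk) (by positivity)
    have hr : |(k : ℝ) / N - ((k - d : ℕ) : ℝ) / (N - d)| ≤ d / (N - d) := by
      rw [abs_le]
      rcases le_total d k with h | h
      · rw [Nat.cast_sub h, div_sub_div _ _ hN0.ne' hNd.ne', le_div_iff₀ (by positivity),
          div_le_div_iff₀ (by positivity) hNd]
        have h1 : ((k : ℝ) * (N - d) - N * (k - d)) = d * (N - k) := by ring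
        rw [h1]
        have h2 : (0 : ℝ) ≤ d * (N - k) := mul_nonneg (by positivity) (by linarith)
        constructor
        · have : -((d : ℝ) / (N - d)) * (N * (N - d)) ≤ 0 := by
            rw [neg_mul]
            have : (0 : ℝ) ≤ (d : ℝ) / (N - d) * (N * (N - d)) := by positivity
            linarith
          linarith
        · have : (d : ℝ) * (N - k) ≤ d * N :=
            mul_le_mul_of_nonneg_left (by linarith [(Nat.cast_nonneg k : (0 : ℝ) ≤ k)]) (by positivity)
          nlinarith
      -- Here `k ≤ d`, so the truncated difference `k - d` is `0`.
      · rw [Nat.sub_eq_zero_of_le h]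
        have h3 : (0 : ℝ) ≤ d / (N - d) := by positivity
        have h4 : (k : ℝ) / N ≤ d / (N - d) :=
          div_le_div₀ (by positivity) (by exact_mod_cast h) hNd (by linarith [(Nat.cast_nonneg d : (0 : ℝ) ≤ d)])
        constructor <;> simp <;> linarith
    have hmon : (d : ℝ) / (N - d) ≤ (d + 1) / (N - (d + 1)) :=
      div_le_div₀ (by positivity) (by linarith) hNd' (by linarith)
    have e : ((k : ℝ) / N) ^ (d + 1) - (k.descFactorial (d + 1) : ℝ) / N.descFactorial (d + 1) =
        (((k : ℝ) / N) ^ d - (k.descFactorial d : ℝ) / N.descFactorial d) * (k / N) +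
        (k.descFactorial d : ℝ) / N.descFactorial d * ((k : ℝ) / N - ((k - d : ℕ) : ℝ) / (N - d)) := by
      rw [Nat.descFactorial_succ, Nat.descFactorial_succ, Nat.cast_mul, Nat.cast_mul,
        Nat.cast_sub (show d ≤ N by omega), mul_div_mul_comm]
      ring
    rw [e]
    calc _ ≤ |((k : ℝ) / N) ^ d - (k.descFactorial d : ℝ) / N.descFactorial d| * (k / N) +
          (k.descFactorial d : ℝ) / N.descFactorial d *
            |(k : ℝ) / N - ((k - d : ℕ) : ℝ) / (N - d)| := by
          refine (abs_add_le _ _).trans_eq ?_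
          rw [abs_mul, abs_mul, abs_of_nonneg hp, abs_of_nonneg hq]
      _ ≤ d * ((d : ℝ) / (N - d)) * 1 + 1 * (d / (N - d)) := by
          gcongr
      _ = (d + 1) * ((d : ℝ) / (N - d)) := by ring
      _ ≤ _ := by gcongr

theorem bernsteinWeight_nonneg {m : ℕ → ℝ} (hm : ∀ n k, 0 ≤ (-1) ^ k * (fwdDiff 1)^[k] m n)
    (N k : ℕ) : 0 ≤ bernsteinWeight m N k :=
  mul_nonneg (Nat.cast_nonneg _) (hm _ _)

theorem sum_bernsteinWeight (m : ℕ → ℝ) (N : ℕ) :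
    ∑ k ∈ Finset.range (N + 1), bernsteinWeight m N k = m 0 := by
  simpa using sum_descFactorial_mul_bernsteinWeight m (Nat.zero_le N)

theorem tendsto_sum_bernsteinWeight_mul_pow {m : ℕ → ℝ}
    (hm : ∀ n k, 0 ≤ (-1) ^ k * (fwdDiff 1)^[k] m n) (d : ℕ) :
    Tendsto (fun N : ℕ => ∑ k ∈ Finset.range (N + 1), bernsteinWeight m N k * ((k : ℝ) / N) ^ d)
      atTop (𝓝 (m d)) := by
  have hlim : Tendsto (fun N : ℕ => d * ((d : ℝ) / (N - d)) * m 0) atTop (𝓝 0) := by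
    have h1 : Tendsto (fun N : ℕ => (N : ℝ) - d) atTop atTop :=
      tendsto_atTop_add_const_right _ _ tendsto_natCast_atTop_atTop
    simpa using ((h1.const_div_atTop (d : ℝ)).const_mul (d : ℝ)).mul_const (m 0)
  rw [tendsto_iff_norm_sub_tendsto_zero]
  refine squeeze_zero' (.of_forall fun _ => norm_nonneg _) ?_ hlim
  filter_upwards [eventually_gt_atTop d] with N hN
  rw [← sum_descFactorial_mul_bernsteinWeight m hN.le, ← Finset.sum_sub_distrib,
    ← sum_bernsteinWeight m N, Finset.mul_sum]
  refine norm_sum_le_of_le _ fun k hk => ?_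
  have hk' : k ≤ N := Nat.lt_succ_iff.1 (Finset.mem_range.1 hk)
  rw [mul_comm, ← sub_mul, norm_mul, Real.norm_of_nonneg (bernsteinWeight_nonneg hm N k)]
  exact mul_le_mul_of_nonneg_right (abs_div_pow_sub_descFactorial_div_le d N k hN hk')
    (bernsteinWeight_nonneg hm N k)

/-- The inclusion of the unit interval into `ℂ`. -/
noncomputable def unitIntervalCoe : C(unitInterval, ℂ) := ⟨fun x => ((x : ℝ) : ℂ), by fun_prop⟩

/-- The Hausdorff moment theorem: a completely monotone sequence is the sequence of moments of a
continuous functional on `C([0, 1])`. -/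
theorem exists_continuousLinearMap_moments {m : ℕ → ℝ}
    (hm : ∀ n k, 0 ≤ (-1) ^ k * (fwdDiff 1)^[k] m n) :
    ∃ g : C(unitInterval, ℂ) →L[ℂ] ℂ, ∀ d, g (unitIntervalCoe ^ d) = m d := by
  -- The projection only serves typing: `k/N` already lies in `[0,1]` for `k ≤ N`.
  let p : ℕ → ℕ → unitInterval := fun N k => Set.projIcc 0 1 zero_le_one ((k : ℝ) / N)
  let A : ℕ → C(unitInterval, ℂ) → ℂ := fun N h =>
    ∑ k ∈ Finset.range (N + 1), (bernsteinWeight m N k : ℂ) * h (p N k)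
  have hA : ∀ N h, A N h ∈ Metric.closedBall (0 : ℂ) (m 0 * ‖h‖) := by
    intro N h
    rw [mem_closedBall_zero_iff, ← sum_bernsteinWeight m N, Finset.sum_mul]
    refine norm_sum_le_of_le _ fun k _ => ?_
    rw [norm_mul, Complex.norm_real, Real.norm_of_nonneg (bernsteinWeight_nonneg hm N k)]
    exact mul_le_mul_of_nonneg_left (h.norm_coe_le_norm _) (bernsteinWeight_nonneg hm N k)
  -- The discrete functionals are uniformly bounded, so an ultrafilter limit exists for every `h` at
  -- once, and uniqueness of limits makes it linear.
  have hlim : ∀ h, ∃ l ∈ Metric.closedBall (0 : ℂ) (m 0 * ‖h‖),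
      Tendsto (fun N => A N h) (hyperfilter ℕ : Filter ℕ) (𝓝 l) := fun h =>
    (isCompact_closedBall (0 : ℂ) (m 0 * ‖h‖)).ultrafilter_le_nhds ((hyperfilter ℕ).map (A · h))
      (le_principal_iff.2 (mem_map.2 (univ_mem' fun N => hA N h)))
  choose g hg hgt using hlim
  let G : C(unitInterval, ℂ) →ₗ[ℂ] ℂ :=
    { toFun := g
      map_add' := fun x y => by
        refine tendsto_nhds_unique (hgt (x + y)) (((hgt x).add (hgt y)).congr fun N => ?_)
        simp only [A, ← Finset.sum_add_distrib, ContinuousMap.add_apply, mul_add]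
      map_smul' := fun c x => by
        refine tendsto_nhds_unique (hgt (c • x)) (((hgt x).const_mul c).congr fun N => ?_)
        simp only [A, Finset.mul_sum, ContinuousMap.smul_apply, smul_eq_mul]
        exact Finset.sum_congr rfl fun _ _ => by ring }
  refine ⟨G.mkContinuous (m 0) fun h => mem_closedBall_zero_iff.1 (hg h), fun d => ?_⟩
  refine tendsto_nhds_unique (hgt (unitIntervalCoe ^ d)) ?_
  have h1 : Tendsto (fun N : ℕ => ((∑ k ∈ Finset.range (N + 1),
      bernsteinWeight m N k * ((k : ℝ) / N) ^ d : ℝ) : ℂ)) atTop (𝓝 (m d : ℂ)) :=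
    (Complex.continuous_ofReal.tendsto _).comp (tendsto_sum_bernsteinWeight_mul_pow hm d)
  refine (h1.mono_left Nat.hyperfilter_le_atTop).congr fun N => ?_
  simp only [A, Complex.ofReal_sum, Complex.ofReal_mul]
  refine Finset.sum_congr rfl fun k hk => ?_
  have hk' : k ≤ N := Nat.lt_succ_iff.1 (Finset.mem_range.1 hk)
  have hmem : (k : ℝ) / N ∈ Set.Icc (0 : ℝ) 1 :=
    ⟨by positivity, div_le_one_of_le₀ (by exact_mod_cast hk') (by positivity)⟩
  simp only [p, Set.projIcc_of_mem zero_le_one hmem, ContinuousMap.pow_apply, unitIntervalCoe,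
    ContinuousMap.coe_mk, Complex.ofReal_pow]

/-- The points `z` for which `1 + z x` does not vanish for `x ∈ [0, 1]`. -/
def stieltjesDomain : Set ℂ := {z | ∀ x : unitInterval, 1 + z * ((x : ℝ) : ℂ) ≠ 0}

/-- Invertibility in the Banach algebra `C([0,1])` gives both openness of the domain and analyticity
of the inverse. -/
theorem mem_stieltjesDomain_iff_isUnit {z : ℂ} :
    z ∈ stieltjesDomain ↔ IsUnit (1 + z • unitIntervalCoe) := by
  rw [ContinuousMap.isUnit_iff_forall_ne_zero]
  rfl

theorem isOpen_stieltjesDomain : IsOpen stieltjesDomain := by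
  have : stieltjesDomain = (fun z : ℂ => 1 + z • unitIntervalCoe) ⁻¹' {u | IsUnit u} :=
    Set.ext fun z => mem_stieltjesDomain_iff_isUnit
  rw [this]
  exact Units.isOpen.preimage (by fun_prop)

theorem zero_mem_stieltjesDomain : (0 : ℂ) ∈ stieltjesDomain := fun x => by simp

theorem isPreconnected_stieltjesDomain : IsPreconnected stieltjesDomain := by
  -- Scaling `z` by `t ∈ [0,1]` amounts to replacing `x` by `tx`.
  have : StarConvex ℝ 0 stieltjesDomain := by
    rw [starConvex_zero_iff]
    intro z hz t h0 h1 x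
    have := hz ⟨t * x, mul_nonneg h0 x.2.1, mul_le_one₀ h1 x.2.1 x.2.2⟩
    convert! this using 2
    simp
    ring
  exact (this.isPathConnected zero_mem_stieltjesDomain).isConnected.isPreconnected

theorem exists_eq_neg_of_notMem_stieltjesDomain {z : ℂ} (hz : z ∉ stieltjesDomain) :
    ∃ x : ℝ, 0 < x ∧ z = -(x : ℂ) := by
  simp only [stieltjesDomain, Set.mem_ofPred_eq, not_forall, not_not] at hz
  obtain ⟨x, hx⟩ := hz
  have hx0 : (x : ℝ) ≠ 0 := by
    intro h
    simp [h] at hx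
  refine ⟨(x : ℝ)⁻¹, inv_pos.2 (lt_of_le_of_ne x.2.1 hx0.symm), ?_⟩
  have : ((x : ℝ) : ℂ) ≠ 0 := by exact_mod_cast hx0
  push_cast
  field_simp
  linear_combination hx

/-- Apply the moment functional to `(1 + zx)⁻¹`; near `0` its Neumann series produces the moments.
-/
theorem exists_stieltjes_extension {m : ℕ → ℝ}
    (hm : ∀ n k, 0 ≤ (-1) ^ k * (fwdDiff 1)^[k] m n) :
    ∃ G : ℂ → ℂ, AnalyticOnNhd ℂ G stieltjesDomain ∧
      ∀ᶠ z in 𝓝 (0 : ℂ), HasSum (fun k => (m k : ℂ) * (-z) ^ k) (G z) := by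
  obtain ⟨g, hg⟩ := exists_continuousLinearMap_moments hm
  refine ⟨fun z => g (Ring.inverse (1 + z • unitIntervalCoe)), ?_, ?_⟩
  · refine DifferentiableOn.analyticOnNhd (fun z hz => ?_) isOpen_stieltjesDomain
    refine DifferentiableAt.differentiableWithinAt ?_
    refine g.differentiableAt.comp z (DifferentiableAt.inverse (by fun_prop) ?_)
    exact mem_stieltjesDomain_iff_isUnit.1 hz
  · have hc : Continuous fun z : ℂ => ‖(-z) • unitIntervalCoe‖ := by fun_prop
    have h0 : ‖(-(0 : ℂ)) • unitIntervalCoe‖ < 1 := by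
      have : (-(0 : ℂ)) • unitIntervalCoe = 0 := by ext x; simp
      rw [this, norm_zero]
      exact one_pos
    filter_upwards [(hc.tendsto 0).eventually_lt_const h0] with z hz
    have e : 1 - (-z) • unitIntervalCoe = 1 + z • unitIntervalCoe := by ext x; simp
    have h := g.hasSum (hasSum_geom_series_inverse _ hz)
    simp only [_root_.smul_pow, map_smul, hg, smul_eq_mul, e] at h
    simpa only [mul_comm] using h

end Hausdorff

/-! ### Complete monotonicity forces positive roots. -/

section Roots

theorem roots_pos_of_completelyMonotone {Λ : ℕ → ℂ} (hs : Summable fun n => ‖(Λ n)⁻¹‖)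
    (hΛ : ∀ n, Λ n ≠ 0) {m : ℕ → ℝ} (hm : ∀ k, (m k : ℂ) = inversePowerSum Λ k)
    (hcm : ∀ n k, 0 ≤ (-1) ^ k * (fwdDiff 1)^[k] m n) (j : ℕ) :
    ∃ x : ℝ, 0 < x ∧ Λ j = (x : ℂ) := by
  by_cases hj : -Λ j ∈ stieltjesDomain
  swap
  · obtain ⟨x, hx, h⟩ := exists_eq_neg_of_notMem_stieltjesDomain hj
    exact ⟨x, hx, neg_injective h⟩
  exfalso
  obtain ⟨G, hG, hGs⟩ := exists_stieltjes_extension hcm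
  obtain ⟨r, hr, hrΛ⟩ := exists_pos_forall_le_norm hs hΛ
  set f := canonicalProd Λ with hf
  have hd : Differentiable ℂ f := differentiable_canonicalProd hs
  have hfa : AnalyticOnNhd ℂ f Set.univ := hd.differentiableOn.analyticOnNhd isOpen_univ
  -- In product form both sides are analytic across possible zeros of `f`, so the identity theorem
  -- applies on the whole domain.
  have hlog : Set.EqOn (deriv f) (f * fun z => deriv f 0 - z * G z) stieltjesDomain := by
    refine (hfa.deriv.mono (Set.subset_univ _)).eqOn_of_preconnected_of_eventuallyEq
      ((hfa.mono (Set.subset_univ _)).mul (analyticOnNhd_const.sub (analyticOnNhd_id.mul hG)))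
      isPreconnected_stieltjesDomain zero_mem_stieltjesDomain ?_
    filter_upwards [hGs, Metric.ball_mem_nhds (0 : ℂ) hr] with z hz hzr
    have hlt : ∀ n, ‖z‖ < ‖Λ n‖ := fun n => (mem_ball_zero_iff.1 hzr).trans_le (hrΛ n)
    simp only [hm] at hz
    have h0 : f z ≠ 0 := canonicalProd_ne_zero hs hΛ fun n h => by simpa [h] using hlt n
    rw [Pi.mul_apply, hf, ← deriv_div_canonicalProd_eq hs hΛ hlt hz, mul_div_cancel₀ _ h0]
  have hz0 : f (-Λ j) = 0 := canonicalProd_neg_root hΛ j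
  -- Differentiation lowers the order of a zero by one, while the product identity makes it no
  -- smaller: the order must be infinite, contradicting `f 0 = 1`.
  have hord := (hfa (-Λ j) trivial).analyticOrderAt_deriv_add_one
  simp only [hz0, sub_zero] at hord
  have hh : AnalyticAt ℂ (fun z => deriv f 0 - z * G z) (-Λ j) :=
    analyticAt_const.sub (analyticAt_id.mul (hG _ hj))
  rw [analyticOrderAt_congr (hlog.eventuallyEq_of_mem (isOpen_stieltjesDomain.mem_nhds hj)),
    analyticOrderAt_mul (hfa _ trivial) hh] at hord
  have htop : analyticOrderAt f (-Λ j) = ⊤ := by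
    by_contra hne
    obtain ⟨a, ha⟩ := ENat.ne_top_iff_exists.1 hne
    rw [← ha] at hord
    have : (a : ℕ∞) + 1 ≤ a := by
      conv_rhs => rw [← hord]
      gcongr
      exact le_self_add
    have h' : a + 1 ≤ a := by exact_mod_cast this
    omega
  have := hfa.eqOn_of_preconnected_of_eventuallyEq analyticOnNhd_const isPreconnected_univ
    (Set.mem_univ (-Λ j)) (g := fun _ => 0) (analyticOrderAt_eq_top.1 htop) (Set.mem_univ 0)
  simp [hf, canonicalProd_zero] at this

end Roots

/-! ### Coefficient recursion. -/

section Recursion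

variable {Λ : ℕ → ℂ}

theorem eventually_forall_norm_lt (hs : Summable fun n => ‖(Λ n)⁻¹‖) (hΛ : ∀ n, Λ n ≠ 0) :
    ∀ᶠ z in 𝓝 (0 : ℂ), ∀ n, ‖z‖ < ‖Λ n‖ := by
  obtain ⟨r, hr, h⟩ := exists_pos_forall_le_norm hs hΛ
  filter_upwards [Metric.ball_mem_nhds (0 : ℂ) hr] with z hz n
  exact (mem_ball_zero_iff.1 hz).trans_le (h n)

theorem hasSum_deriv_of_hasSum_pow {c : ℕ → ℂ} {φ : ℂ → ℂ}
    (h : ∀ᶠ z in 𝓝 (0 : ℂ), HasSum (fun k => c k * z ^ k) (φ z)) :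
    ∀ᶠ z in 𝓝 (0 : ℂ), HasSum (fun k : ℕ => ((k : ℂ) + 1) * c (k + 1) * z ^ k) (deriv φ z) := by
  filter_upwards [(hasFPowerSeriesAt_ofScalars_of_eventually_hasSum
    h).analyticAt.deriv.eventually_hasSum_iteratedDeriv] with z hz
  convert! hz using 1
  funext k
  have hk : ((k : ℂ) + 1) ≠ 0 := by exact_mod_cast Nat.succ_ne_zero k
  have hk' : (k.factorial : ℂ) ≠ 0 := by exact_mod_cast k.factorial_ne_zero
  rw [coeff_eq_iteratedDeriv_div_factorial h (k + 1), iteratedDeriv_succ', Nat.factorial_succ]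
  push_cast
  field_simp

/-- Both sides are coefficients of `(a₁ f - f')/z`, computed as a Cauchy product of `f` with the
moment series and directly. -/
theorem sum_coeff_mul_inversePowerSum (hs : Summable fun n => ‖(Λ n)⁻¹‖) (hΛ : ∀ n, Λ n ≠ 0)
    {a : ℕ → ℂ} (ha0 : a 0 = 1)
    (hf : ∀ z : ℂ, HasSum (fun n : ℕ => a n * z ^ n) (canonicalProd Λ z)) (l : ℕ) :
    ∑ k ∈ Finset.range (l + 1), a k * ((-1) ^ (l - k) * inversePowerSum Λ (l - k)) =
      a 1 * a (l + 1) - ((l : ℂ) + 2) * a (l + 2) := by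
  have hd := hasSum_deriv_of_hasSum_pow (.of_forall hf)
  have ha1 : deriv (canonicalProd Λ) 0 = a 1 := by
    have := hd.self_of_nhds.unique (hasSum_single 0 fun k hk => by simp [hk])
    simpa using this
  have key : (fun l => ∑ k ∈ Finset.range (l + 1),
      a k * ((-1) ^ (l - k) * inversePowerSum Λ (l - k))) =
      fun l : ℕ => a 1 * a (l + 1) - ((l : ℂ) + 2) * a (l + 2) := by
    refine coeff_unique_of_eventually_hasSum
      (φ := fun z => (a 1 * canonicalProd Λ z - deriv (canonicalProd Λ) z) / z) ?_ ?_
    · filter_upwards [(eventually_forall_norm_lt hs hΛ).filter_mono nhdsWithin_le_nhds,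
        self_mem_nhdsWithin] with z hz (hz0 : z ≠ 0)
      obtain ⟨S, -, hS⟩ := hasSum_inversePowerSum_mul_pow hs hΛ hz
      have hlog := deriv_div_canonicalProd_eq hs hΛ hz hS
      have hne : canonicalProd Λ z ≠ 0 :=
        canonicalProd_ne_zero hs hΛ fun n h => by simpa [h] using hz n
      have hprod := hasSum_sum_range_mul_of_summable_norm (hf z).summable.norm hS.summable.norm
      rw [(hf z).tsum_eq, hS.tsum_eq] at hprod
      convert! hprod using 1
      · funext n
        rw [Finset.sum_mul]
        refine Finset.sum_congr rfl fun k hk => ?_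
        have hk' : k ≤ n := Nat.lt_succ_iff.1 (Finset.mem_range.1 hk)
        rw [neg_pow z, ← pow_sub_mul_pow z hk']
        ring
      · rw [div_eq_iff hne, ha1] at hlog
        rw [hlog]
        field_simp
        ring
    · filter_upwards [hd.filter_mono nhdsWithin_le_nhds, self_mem_nhdsWithin]
        with z hz (hz0 : z ≠ 0)
      have h := ((hf z).mul_left (a 1)).sub hz
      -- The constant term `a₁ a₀ - a₁` vanishes, so division by `z` shifts the index.
      have h' := (hasSum_nat_add_iff' 1).2 h
      convert! h'.div_const z using 1
      · funext k
        push_cast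
        field_simp
        ring
      · simp [ha0]
  exact congrFun key l

end Recursion

/-! ### Determinant, reality and differences of the moments. -/

/-- With `T` the unitriangular Toeplitz matrix, the recursion says that the last column is `T b`;
Cramer's rule then gives `det T · b_l = b_l`. -/
theorem det_momentMatrix {a b : ℕ → ℝ} (ha0 : a 0 = 1)
    (h : ∀ l, ∑ k ∈ Finset.range (l + 1), a k * b (l - k) =
      a 1 * a (l + 1) - ((l : ℝ) + 2) * a (l + 2)) (l : ℕ) :
    (momentMatrix a l).det = b l := by
  let T : Matrix (Fin (l + 1)) (Fin (l + 1)) ℝ :=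
    Matrix.of fun i j => if (j : ℕ) ≤ i then a (i - j) else 0
  have hT : T.det = 1 := by
    rw [Matrix.det_of_isLowerTriangular]
    · simp [T, ha0]
    · intro i j hij
      have : ¬ j ≤ i := not_le.2 hij
      simp [T, this]
  have hmul : T.mulVec (fun j => b j) =
      fun i : Fin (l + 1) => a 1 * a ((i : ℕ) + 1) - ((i : ℕ) + 2 : ℝ) * a ((i : ℕ) + 2) := by
    funext i
    rw [← h i, ← Finset.sum_range_reflect]
    simp only [Matrix.mulVec, dotProduct, T, Matrix.of_apply, ite_mul, zero_mul]
    rw [Fin.sum_univ_eq_sum_range (fun j => if j ≤ (i : ℕ) then a (i - j) * b j else 0),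
      ← Finset.sum_filter]
    refine Finset.sum_congr ?_ fun k hk => ?_
    · ext k
      have := i.2
      simp only [Finset.mem_filter, Finset.mem_range]
      omega
    · have hk := Finset.mem_range.1 hk
      congr 2
      omega
  have hM : momentMatrix a l = T.updateCol (Fin.last l) (T.mulVec fun j => b j) := by
    ext i j
    rw [hmul, Matrix.updateCol_apply]
    by_cases hj : j = Fin.last l
    · simp [momentMatrix, hj]
    · have : (j : ℕ) ≠ l := fun e => hj (Fin.ext e)
      simp [momentMatrix, hj, this, T]
  rw [hM, ← Matrix.cramer_apply, Matrix.cramer_eq_adjugate_mulVec, Matrix.mulVec_mulVec,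
    Matrix.adjugate_mul, hT, one_smul, Matrix.one_mulVec]
  simp

theorem sum_range_succ_eq_add_sum_Icc (g : ℕ → ℝ) (l : ℕ) :
    ∑ k ∈ Finset.range (l + 1), g k = g 0 + ∑ k ∈ Finset.Icc 1 l, g k := by
  have : Finset.range (l + 1) = insert 0 (Finset.Icc 1 l) := by
    ext k
    simp only [Finset.mem_range, Finset.mem_insert, Finset.mem_Icc]
    omega
  rw [this, Finset.sum_insert (by simp)]

/-- As `a 0 = 1`, the recursion expresses each power sum through real coefficients and earlier power
sums. -/
theorem exists_real_inversePowerSum {Λ : ℕ → ℂ} (hs : Summable fun n => ‖(Λ n)⁻¹‖)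
    (hΛ : ∀ n, Λ n ≠ 0) {a : ℕ → ℝ} (ha0 : a 0 = 1)
    (hf : ∀ z : ℂ, HasSum (fun n : ℕ => (a n : ℂ) * z ^ n) (canonicalProd Λ z)) :
    ∃ m : ℕ → ℝ, ∀ k, (m k : ℂ) = inversePowerSum Λ k := by
  have h := sum_coeff_mul_inversePowerSum hs hΛ (a := fun n => (a n : ℂ)) (by simp [ha0]) hf
  suffices ∀ k, ∃ x : ℝ, (x : ℂ) = inversePowerSum Λ k from ⟨_, fun k => (this k).choose_spec⟩
  intro k
  induction k using Nat.strong_induction_on with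
  | _ l ih =>
    have hx : ∀ k, ∃ x : ℝ, k ∈ Finset.range l → (x : ℂ) = inversePowerSum Λ (l - (k + 1)) := by
      intro k
      by_cases hk : k ∈ Finset.range l
      · obtain ⟨x, hx⟩ := ih (l - (k + 1)) (by have := Finset.mem_range.1 hk; omega)
        exact ⟨x, fun _ => hx⟩
      · exact ⟨0, fun h => absurd h hk⟩
    choose x hx using hx
    refine ⟨(-1) ^ l * (a 1 * a (l + 1) - ((l : ℝ) + 2) * a (l + 2) -
      ∑ k ∈ Finset.range l, a (k + 1) * ((-1) ^ (l - (k + 1)) * x k)), ?_⟩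
    have hl := h l
    rw [Finset.sum_range_succ'] at hl
    have e : ∑ k ∈ Finset.range l, (a (k + 1) : ℂ) * ((-1) ^ (l - (k + 1)) * (x k : ℂ)) =
        ∑ k ∈ Finset.range l,
          (a (k + 1) : ℂ) * ((-1) ^ (l - (k + 1)) * inversePowerSum Λ (l - (k + 1))) :=
      Finset.sum_congr rfl fun k hk => by rw [hx k hk]
    push_cast
    rw [← hl, e]
    simp only [ha0, Nat.sub_zero, add_sub_cancel_left, Complex.ofReal_one, one_mul]
    rw [← mul_assoc, ← mul_pow]
    simp

/-- Each further `-Δ` in `n` multiplies the `j`-th term by `1 - 1/Λ j`. -/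
theorem hasSum_fwdDiff_inversePowerSum {Λ : ℕ → ℂ} (hs : Summable fun n => ‖(Λ n)⁻¹‖)
    {m : ℕ → ℝ} (hm : ∀ k, (m k : ℂ) = inversePowerSum Λ k) (n k : ℕ) :
    HasSum (fun j => 1 / Λ j ^ (n + 2) * (1 - 1 / Λ j) ^ k)
      (((-1) ^ k * (fwdDiff 1)^[k] m n : ℝ) : ℂ) := by
  induction k generalizing n with
  | zero => simpa [hm] using hasSum_inversePowerSum hs n
  | succ k ih =>
    convert! (ih n).sub (ih (n + 1)) using 1
    · funext j
      simp only [one_div, ← inv_pow]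
      ring
    · rw [Function.iterate_succ_apply']
      simp only [fwdDiff]
      push_cast
      ring

theorem fwdDiff_nonneg_of_roots_pos {Λ : ℕ → ℂ} (hs : Summable fun n => ‖(Λ n)⁻¹‖)
    {m : ℕ → ℝ} (hm : ∀ k, (m k : ℂ) = inversePowerSum Λ k)
    (hpos : ∀ n, ∃ x : ℝ, 1 ≤ x ∧ Λ n = (x : ℂ)) (n k : ℕ) :
    0 ≤ (-1) ^ k * (fwdDiff 1)^[k] m n := by
  choose x hx1 hx using hpos
  have h := hasSum_fwdDiff_inversePowerSum hs hm n k
  simp only [hx] at h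
  have h' : HasSum (fun j => 1 / x j ^ (n + 2) * (1 - 1 / x j) ^ k)
      ((-1) ^ k * (fwdDiff 1)^[k] m n) := by
    rw [← Complex.hasSum_ofReal]
    exact_mod_cast h
  refine h'.nonneg fun j => ?_
  have h0 : 0 < x j := by linarith [hx1 j]
  have h1 : 1 / x j ≤ 1 := (div_le_one h0).2 (hx1 j)
  have h2 : 0 ≤ 1 - 1 / x j := by linarith
  positivity

/-! ### Assembly of the theorem. -/

theorem theorem2 (Λ : ℕ → ℂ) (α₀ β₀ : ℝ) (hα : 0 < α₀ ∧ α₀ < 1) (hβ : 0 < β₀ ∧ β₀ < 1)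
    (hΛ : ∀ n, Λ n ≠ 0)
    (hsector : ∀ n, β₀ * ‖Λ n‖ ≤ (Λ n).re)
    (hsum : Summable fun n => 1 / ‖Λ n‖ ^ α₀)
    (a : ℕ → ℝ) (ha0 : a 0 = 1) (ha : ∀ n, 0 < a n)
    (hf : ∀ z : ℂ, HasSum (fun n : ℕ => (a n : ℂ) * z ^ n) (canonicalProd Λ z)) :
    ∃ m : ℕ → ℝ,
      -- the expansion exists, has real coefficients `m`, and determines them
      (∀ m' : ℕ → ℂ, IsMomentSeq Λ m' ↔ m' = fun k => (m k : ℂ)) ∧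
      -- it holds in the largest disc free of zeros, so in `|z| < 1` if all `|Λₙ| ≥ 1`
      (∀ z : ℂ, z ≠ 0 → (∀ n, ‖z‖ < ‖Λ n‖) →
        HasSum (fun k : ℕ => (m k : ℂ) * (-z) ^ k) (momentGen Λ z)) ∧
      -- formulas for the coefficients
      AnalyticAt ℂ (momentGenExt Λ) 0 ∧
      AnalyticAt ℂ (fun z => deriv (canonicalProd Λ) z / canonicalProd Λ z) 0 ∧
      (∀ k : ℕ,
        (m k : ℂ) = (-1) ^ k / (k.factorial : ℂ) * iteratedDeriv k (momentGenExt Λ) 0 ∧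
        (m k : ℂ) = (-1) ^ (k + 1) / ((k + 1).factorial : ℂ) *
          iteratedDeriv (k + 1) (fun z => deriv (canonicalProd Λ) z / canonicalProd Λ z) 0 ∧
        HasSum (fun n => 1 / Λ n ^ (k + 2)) (m k : ℂ)) ∧
      -- the differences of the moments
      (∀ n k : ℕ, HasSum (fun j => 1 / Λ j ^ (n + 2) * (1 - 1 / Λ j) ^ k)
        (((-1) ^ k * (fwdDiff 1)^[k] m n : ℝ) : ℂ)) ∧
      -- the criterion for positivity
      (1 < (⨅ n, (Λ n).re) →
        ((∀ n, ∃ x : ℝ, 0 < x ∧ Λ n = (x : ℂ)) ↔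
          ∀ n k : ℕ, 0 ≤ (-1) ^ k * (fwdDiff 1)^[k] m n)) ∧
      -- the determinant and the recursion
      (∀ l : ℕ, (-1) ^ l * m l = (momentMatrix a l).det) ∧
      (∀ l : ℕ, (-1) ^ l * m l = a 1 * a (l + 1) - ((l : ℝ) + 2) * a (l + 2)
        - ∑ k ∈ Finset.Icc 1 l, m (l - k) * (-1) ^ (l - k) * a k) := by
  have hs := summable_inv_norm_of_rpow hα.1 hα.2.le hΛ hsum
  obtain ⟨m, hm⟩ := exists_real_inversePowerSum hs hΛ ha0 hf
  have hev := eventually_forall_norm_lt hs hΛ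
  have hexp : ∀ z : ℂ, z ≠ 0 → (∀ n, ‖z‖ < ‖Λ n‖) →
      HasSum (fun k : ℕ => (m k : ℂ) * (-z) ^ k) (momentGen Λ z) := by
    intro z h0 hz
    simpa only [hm] using hasSum_momentGen hs hΛ h0 hz
  have hmv : ∀ m' : ℕ → ℂ, IsMomentSeq Λ m' ↔
      ∀ᶠ z in 𝓝[≠] (0 : ℂ), HasSum (fun k => (m' k * (-1) ^ k) * z ^ k) (momentGen Λ z) := by
    intro m'
    have e : ∀ (z : ℂ) (k : ℕ), (m' k * (-1) ^ k) * z ^ k = m' k * (-z) ^ k := by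
      intro z k
      rw [neg_pow z]
      ring
    simp only [e, eventually_nhdsWithin_iff, Metric.eventually_nhds_iff, IsMomentSeq,
      dist_zero_right, Set.mem_compl_iff, Set.mem_singleton_iff]
    exact exists_congr fun r => and_congr_right fun _ =>
      ⟨fun h z hz h0 => h z h0 hz, fun h z h0 hz => h hz h0⟩
  have hmm : IsMomentSeq Λ fun k => (m k : ℂ) := by
    obtain ⟨r, hr, h⟩ := exists_pos_forall_le_norm hs hΛ
    exact ⟨r, hr, fun z h0 hz => hexp z h0 fun n => hz.trans_le (h n)⟩
  have hext : ∀ᶠ z in 𝓝 (0 : ℂ),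
      HasSum (fun k => ((m k : ℂ) * (-1) ^ k) * z ^ k) (momentGenExt Λ z) := by
    have h1 := (hmv _).1 hmm
    have h2 := eventually_nhds_zero_hasSum_tsum h1
    -- This identifies the `limUnder` value at the origin as `m 0`.
    have hlim : Tendsto (momentGen Λ) (𝓝[≠] 0) (𝓝 (m 0 : ℂ)) := by
      have hc := (hasFPowerSeriesAt_ofScalars_of_eventually_hasSum
        h2).continuousAt.continuousWithinAt (s := {0}ᶜ)
      have hv : (∑' k, ((m k : ℂ) * (-1) ^ k) * (0 : ℂ) ^ k) = m 0 := by
        rw [tsum_eq_single 0 fun k hk => by simp [hk]]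
        simp
      rw [ContinuousWithinAt, hv] at hc
      exact hc.congr' (h1.mono fun z hz => hz.tsum_eq)
    rw [eventually_nhdsWithin_iff] at h1
    filter_upwards [h1] with z hz
    by_cases h0 : z = 0
    · subst h0
      rw [momentGenExt, Function.update_self, hlim.limUnder_eq]
      convert! hasSum_single (f := fun k => ((m k : ℂ) * (-1) ^ k) * (0 : ℂ) ^ k) 0
        (fun k hk => by simp [hk]) using 1
      simp
    · rw [momentGenExt, Function.update_of_ne h0]
      exact hz h0
  have hlog : ∀ᶠ z in 𝓝 (0 : ℂ),
      HasSum (fun k => (if k = 0 then deriv (canonicalProd Λ) 0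
        else (m (k - 1) : ℂ) * (-1) ^ k) * z ^ k)
        (deriv (canonicalProd Λ) z / canonicalProd Λ z) := by
    filter_upwards [hev] with z hz
    obtain ⟨S, -, hS⟩ := hasSum_inversePowerSum_mul_pow hs hΛ hz
    rw [deriv_div_canonicalProd_eq hs hΛ hz hS, ← hasSum_nat_add_iff' 1]
    convert! (hS.mul_left (-z)) using 1
    · funext k
      simp only [Nat.add_one_ne_zero, if_false, Nat.add_sub_cancel, hm]
      rw [neg_pow z]
      ring
    · simp
  have hrec : ∀ l : ℕ, ∑ k ∈ Finset.range (l + 1), a k * ((-1) ^ (l - k) * m (l - k)) =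
      a 1 * a (l + 1) - ((l : ℝ) + 2) * a (l + 2) := by
    intro l
    have h := sum_coeff_mul_inversePowerSum hs hΛ (a := fun n => (a n : ℂ)) (by simp [ha0]) hf l
    simp only [← hm] at h
    exact_mod_cast h
  refine ⟨m, fun m' => ⟨fun h => ?_, fun h => h ▸ hmm⟩, hexp,
    (hasFPowerSeriesAt_ofScalars_of_eventually_hasSum hext).analyticAt,
    (hasFPowerSeriesAt_ofScalars_of_eventually_hasSum hlog).analyticAt,
    fun k => ⟨?_, ?_, ?_⟩, hasSum_fwdDiff_inversePowerSum hs hm,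
    fun hinf => ⟨fun hpos => fwdDiff_nonneg_of_roots_pos hs hm fun n => ?_,
      fun hcm => roots_pos_of_completelyMonotone hs hΛ hm hcm⟩, fun l => ?_, fun l => ?_⟩
  · have := coeff_unique_of_eventually_hasSum ((hmv m').1 h) ((hmv _).1 hmm)
    funext k
    exact mul_right_cancel₀ (pow_ne_zero k (by norm_num)) (congrFun this k)
  · have h := coeff_eq_iteratedDeriv_div_factorial hext k
    rw [div_mul_eq_mul_div, mul_div_assoc, ← h, mul_left_comm, ← mul_pow]
    simp
  · have h := coeff_eq_iteratedDeriv_div_factorial hlog (k + 1)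
    rw [if_neg k.succ_ne_zero, Nat.add_sub_cancel] at h
    rw [div_mul_eq_mul_div, mul_div_assoc, ← h, mul_left_comm, ← mul_pow]
    simp
  · rw [hm]
    simpa only [one_div, ← inv_pow] using hasSum_inversePowerSum hs k
  · obtain ⟨x, -, hx⟩ := hpos n
    -- A real infimum bounds its terms only for a set bounded below; the sector condition gives the
    -- bound `0`.
    have hbdd : BddBelow (Set.range fun n => (Λ n).re) := by
      refine ⟨0, ?_⟩
      rintro _ ⟨n, rfl⟩
      exact (mul_nonneg hβ.1.le (norm_nonneg _)).trans (hsector n)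
    have := hinf.trans_le (ciInf_le hbdd n)
    rw [hx, Complex.ofReal_re] at this
    exact ⟨x, this.le, hx⟩
  · exact (det_momentMatrix (b := fun k => (-1) ^ k * m k) ha0 hrec l).symm
  · rw [← hrec l, sum_range_succ_eq_add_sum_Icc, ha0, one_mul, Nat.sub_zero, add_sub_assoc,
      ← Finset.sum_sub_distrib, Finset.sum_eq_zero fun k _ => by ring, add_zero]
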